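/- Let $n\ge 2$, $m=[n/2]$, and let $(M^n,g)$ be a smooth oriented Riemannian manifold without boundary with a $\mathrm{Spin}^{\mathbb C}$ structure, given by an open cover $\{U_\alpha\}$, smooth oriented orthonormal frames $(E_1^\alpha,\dots,E_n^\alpha)$ on $U_\alpha$ and smooth transition functions $g_{\alpha\beta}:U_\alpha\cap U_\beta\to \mathrm{Spin}^{\mathbb C}(n)=(\mathrm{Spin}(n)\times S^1)/\{\pm(1,1)\}$ satisfying the cocycle condition and covering the change of frames. Let $L$ be the complex line bundle with transition functions $\det g_{\alpha\beta}$, where $\det(a\otimes z)=z^2$, and let $A$ be a $U(1)$-connection on $L$, given by real $1$-forms $A_\alpha$ for which $d+\sqrt{-1}A_\alpha$ is the local covariant derivative of $L$. The conjugate structure has transition functions $\overline{g_{\alpha\beta}}$, where $\overline{a\otimes z}=a\otimes\bar z$; its line bundle is $-L$, with the connection $-A$. Let $\Delta_n=(\mathbb C^2)^{\otimes m}$, $g_1=\begin{pmatrix}\sqrt{-1}&0\\0&-\sqrt{-1}\end{pmatrix}$, $g_2=\begin{pmatrix}0&\sqrt{-1}\\ \sqrt{-1}&0\end{pmatrix}$,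 $T=\begin{pmatrix}0&-\sqrt{-1}\\ \sqrt{-1}&0\end{pmatrix}$, and let Clifford multiplication on $\Delta_n$ be given by $e_{2\alpha-1}=T^{\otimes(\alpha-1)}\otimes g_1\otimes 1^{\otimes(m-\alpha)}$ and $e_{2\alpha}=T^{\otimes(\alpha-1)}\otimes g_2\otimes 1^{\otimes(m-\alpha)}$ for $1\le\alpha\le m$, and $e_{2m+1}=\sqrt{-1}\,T^{\otimes m}$ if $n=2m+1$. For $\epsilon=\pm1$ put $u(\epsilon)=\frac1{\sqrt2}(1,-\epsilon\sqrt{-1})$ and $u(\epsilon_1,\dots,\epsilon_m)=u(\epsilon_1)\otimes\cdots\otimes u(\epsilon_m)$, and let $j_0,j_1:\Delta_n\to\Delta_n$ be the complex-antilinear maps with $$j_0u(\epsilon_1,\dots,\epsilon_m)=(\sqrt{-1})^{\sum_{\alpha}\alpha\epsilon_\alpha}u(-\epsilon_1,\dots,-\epsilon_m),\qquad j_1u(\epsilon_1,\dots,\epsilon_m)=(\sqrt{-1})^{\sum_{\alpha}(m-\alpha+1)\epsilon_\alpha}u(-\epsilon_1,\dots,-\epsilon_m).$$ Smooth sections $s$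 of the spinor bundle $\Sigma(M,L)$ are families of smooth functions $s_\alpha:U_\alpha\to\Delta_n$ with $s_\beta=g_{\alpha\beta}s_\alpha$ on overlaps; those of $\Sigma(M,-L)$ are defined likewise with $\overline{g_{\alpha\beta}}$. The $\mathrm{Spin}^{\mathbb C}$ Dirac operator $D^A$ is, on $U_\alpha$, $$D^As=\sum_{k}e_k\cdot\nabla^A_{E_k}s,\qquad \nabla^A_Xs=X(s)+\tfrac12\Big(\sqrt{-1}A_\alpha(X)+\sum_{i<j}g(\nabla_XE_i,E_j)\,e_ie_j\Big)\cdot s,$$ where $\nabla$ is the Levi-Civita connection of $g$, and $D^{-A}$ is the corresponding operator for $\Sigma(M,-L)$ and $-A$. 1. If $n\not\equiv1\bmod 4$, then $j_0$, applied in each local trivialization, maps smooth sections of $\Sigma(M,L)$ to smooth sections of $\Sigma(M,-L)$, and $D^{-A}\circ j_0=j_0\circ D^A$. 2. For every $n\ge2$, $j_1$ likewise maps smooth sections of $\Sigma(M,L)$ to smooth sections of $\Sigma(M,-L)$, and $D^{-A}\circ j_1=(-1)^{m+1}j_1\circ D^A$. 3. Suppose that $M$ is closed, and let $\mathrm{Spec}$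 denote the set of the (real) eigenvalues, the multiplicity of $\lambda\in\mathbb R$ being the dimension of the space of smooth sections $s$ with $D^As=\lambda s$. If $m$ is odd, then $\mathrm{Spec}(D^A)=\mathrm{Spec}(D^{-A})$, and every $\lambda\in\mathbb R$ has the same multiplicity for $D^A$ and $D^{-A}$. If $m$ is even, then $\mathrm{Spec}(D^A)=-\mathrm{Spec}(D^{-A})$, and the multiplicity of $\lambda$ for $D^A$ equals that of $-\lambda$ for $D^{-A}$. -/

import Mathlib

open scoped Manifold ContDiff Matrix
open Bundle

namespace SpinCDirac

/-! ### The spinor representation -/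

/-- The spinor space `Δ_n = (ℂ²)^{⊗ m}` with `m = [n / 2]`: a tensor is given by its `2 ^ m`
coordinates in the standard basis. -/
abbrev Spinor (n : ℕ) : Type := (Fin (n / 2) → Fin 2) → ℂ

/-- The Kronecker product `M 0 ⊗ M 1 ⊗ ⋯ ⊗ M (m - 1)` of `2 × 2` matrices. -/
def tensorMatrix {m : ℕ} (M : Fin m → Matrix (Fin 2) (Fin 2) ℂ) :
    Matrix (Fin m → Fin 2) (Fin m → Fin 2) ℂ :=
  Matrix.of fun a b => ∏ β, M β (a β) (b β)

theorem tensorMatrix_mul {m : ℕ} (M N : Fin m → Matrix (Fin 2) (Fin 2) ℂ) :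
    tensorMatrix M * tensorMatrix N = tensorMatrix (fun β => M β * N β) := by
  ext a b
  simp only [tensorMatrix, Matrix.mul_apply, Matrix.of_apply, ← Finset.prod_mul_distrib]
  rw [Finset.prod_univ_sum, Fintype.piFinset_univ]

theorem tensorMatrix_smul {m : ℕ} (c : Fin m → ℂ) (M : Fin m → Matrix (Fin 2) (Fin 2) ℂ) :
    tensorMatrix (fun β => c β • M β) = (∏ β, c β) • tensorMatrix M := by
  ext a b
  simp [tensorMatrix, Finset.prod_mul_distrib]

theorem tensorMatrix_one {m : ℕ} :
    tensorMatrix (fun _ : Fin m => (1 : Matrix (Fin 2) (Fin 2) ℂ)) = 1 := by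
  ext a b
  simp only [tensorMatrix, Matrix.of_apply, Matrix.one_apply]
  by_cases h : a = b
  · subst h
    simp
  · rw [if_neg h]
    obtain ⟨β, hβ⟩ := Function.ne_iff.mp h
    exact Finset.prod_eq_zero (Finset.mem_univ β) (if_neg hβ)

def g₁ : Matrix (Fin 2) (Fin 2) ℂ := !![Complex.I, 0; 0, -Complex.I]

def g₂ : Matrix (Fin 2) (Fin 2) ℂ := !![0, Complex.I; Complex.I, 0]

def T : Matrix (Fin 2) (Fin 2) ℂ := !![0, -Complex.I; Complex.I, 0]

/-- The matrix at position `β` of the Clifford matrix of the basis vector with index `k`. -/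
def gammaFactor (k β : ℕ) : Matrix (Fin 2) (Fin 2) ℂ :=
  if β < k / 2 then T else if β = k / 2 then (if k % 2 = 0 then g₁ else g₂) else 1

/-- Clifford multiplication by the standard basis vectors of `ℝⁿ` on `Δ_n`. With `1`-based indices,
`e_{2α-1} = T ⊗ ⋯ ⊗ T ⊗ g₁ ⊗ 1 ⊗ ⋯ ⊗ 1` and `e_{2α} = T ⊗ ⋯ ⊗ T ⊗ g₂ ⊗ 1 ⊗ ⋯ ⊗ 1`, with `α - 1`
factors `T`, and `e_{2m+1} = √-1 T ⊗ ⋯ ⊗ T` when `n = 2m + 1`. -/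
noncomputable def gamma (n : ℕ) (k : Fin n) :
    Matrix (Fin (n / 2) → Fin 2) (Fin (n / 2) → Fin 2) ℂ :=
  if (k : ℕ) < 2 * (n / 2) then tensorMatrix (fun β => gammaFactor k β)
  else Complex.I • tensorMatrix (fun _ => T)

theorem sq_g₁ : g₁ * g₁ = (-1 : ℂ) • (1 : Matrix (Fin 2) (Fin 2) ℂ) := by
  ext i j; fin_cases i <;> fin_cases j <;> simp [g₁]

theorem sq_g₂ : g₂ * g₂ = (-1 : ℂ) • (1 : Matrix (Fin 2) (Fin 2) ℂ) := by
  ext i j; fin_cases i <;> fin_cases j <;> simp [g₂]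

theorem sq_T : T * T = (1 : ℂ) • (1 : Matrix (Fin 2) (Fin 2) ℂ) := by
  ext i j; fin_cases i <;> fin_cases j <;> simp [T]

theorem g₁_mul_g₂ : g₁ * g₂ = (-1 : ℂ) • (g₂ * g₁) := by
  ext i j; fin_cases i <;> fin_cases j <;> simp [g₁, g₂]

theorem g₁_mul_T : g₁ * T = (-1 : ℂ) • (T * g₁) := by
  ext i j; fin_cases i <;> fin_cases j <;> simp [g₁, T]

theorem g₂_mul_T : g₂ * T = (-1 : ℂ) • (T * g₂) := by
  ext i j; fin_cases i <;> fin_cases j <;> simp [g₂, T]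

theorem gammaFactor_sq (k β : ℕ) :
    gammaFactor k β * gammaFactor k β = (if β = k / 2 then (-1 : ℂ) else 1) • 1 := by
  unfold gammaFactor
  split_ifs <;> first | omega | simp [sq_g₁, sq_g₂, sq_T]

theorem gammaFactor_mul_T (k β : ℕ) :
    gammaFactor k β * T = (if β = k / 2 then (-1 : ℂ) else 1) • (T * gammaFactor k β) := by
  unfold gammaFactor
  split_ifs <;> first | omega | simp [g₁_mul_T, g₂_mul_T]

theorem gammaFactor_mul (k l β : ℕ) (h : k < l) :
    gammaFactor k β * gammaFactor l β =
      (if β = k / 2 then (-1 : ℂ) else 1) • (gammaFactor l β * gammaFactor k β) := by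
  unfold gammaFactor
  split_ifs <;> first | omega | simp [g₁_mul_T, g₂_mul_T, g₁_mul_g₂]

theorem prod_sign {m k : ℕ} (hk : k < 2 * m) :
    ∏ β : Fin m, (if (β : ℕ) = k / 2 then (-1 : ℂ) else 1) = -1 := by
  rw [Finset.prod_eq_single (⟨k / 2, by omega⟩ : Fin m)]
  · simp
  · intro b _ hb
    rw [if_neg]
    exact fun h => hb (Fin.ext h)
  · simp

theorem gamma_sq (n : ℕ) (k : Fin n) : gamma n k * gamma n k = -1 := by
  unfold gamma
  split_ifs with h
  · rw [tensorMatrix_mul]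
    simp_rw [gammaFactor_sq]
    rw [tensorMatrix_smul, prod_sign h, tensorMatrix_one, neg_smul, one_smul]
  · rw [Matrix.smul_mul, Matrix.mul_smul, smul_smul, Complex.I_mul_I, tensorMatrix_mul]
    simp_rw [sq_T, one_smul]
    rw [tensorMatrix_one, neg_smul, one_smul]

theorem gamma_mul_of_lt (n : ℕ) (k l : Fin n) (hkl : (k : ℕ) < l) :
    gamma n k * gamma n l = -(gamma n l * gamma n k) := by
  have hk : (k : ℕ) < 2 * (n / 2) := by have := l.2; omega
  unfold gamma
  rw [if_pos hk]
  split_ifs with h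
  · rw [tensorMatrix_mul, tensorMatrix_mul]
    simp_rw [gammaFactor_mul _ _ _ hkl]
    rw [tensorMatrix_smul, prod_sign hk, neg_smul, one_smul]
  · rw [Matrix.smul_mul, Matrix.mul_smul, tensorMatrix_mul, tensorMatrix_mul]
    simp_rw [gammaFactor_mul_T]
    rw [tensorMatrix_smul, prod_sign hk, neg_smul, one_smul, smul_neg]

theorem gamma_anticomm (n : ℕ) (k l : Fin n) :
    gamma n k * gamma n l + gamma n l * gamma n k = if k = l then -2 else 0 := by
  rcases lt_trichotomy (k : ℕ) l with h | h | h
  · rw [if_neg (fun e => by simp [e] at h), gamma_mul_of_lt n k l h, neg_add_cancel]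
  · have e : k = l := Fin.ext h
    subst e
    rw [if_pos rfl, gamma_sq]
    norm_num
  · rw [if_neg (fun e => by simp [e] at h), gamma_mul_of_lt n l k h, add_neg_cancel]

/-- The quadratic form `-|v|²` on `ℝⁿ`, so that `e_i² = -1` in the Clifford algebra. -/
noncomputable def negForm (n : ℕ) : QuadraticForm ℝ (Fin n → ℝ) :=
  QuadraticMap.weightedSumSquares ℝ (fun _ : Fin n => (-1 : ℝ))

/-- The real Clifford algebra `Cl(ℝⁿ)`. -/
abbrev Cl (n : ℕ) : Type := CliffordAlgebra (negForm n)

/-- The basis vector `e_i` in the Clifford algebra. -/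
noncomputable def e (n : ℕ) (i : Fin n) : Cl n :=
  CliffordAlgebra.ι (negForm n) (Pi.single i 1)

theorem gamma_vector_sq (n : ℕ) (v : Fin n → ℝ) :
    Fintype.linearCombination ℝ (gamma n) v * Fintype.linearCombination ℝ (gamma n) v =
      algebraMap ℝ _ (negForm n v) := by
  have h2 : (2 : ℝ) • (Fintype.linearCombination ℝ (gamma n) v *
      Fintype.linearCombination ℝ (gamma n) v) = (2 : ℝ) • algebraMap ℝ _ (negForm n v) := by
    rw [two_smul]
    simp only [Fintype.linearCombination_apply, Finset.sum_mul_sum]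
    nth_rewrite 2 [Finset.sum_comm]
    simp only [← Finset.sum_add_distrib, smul_mul_smul_comm]
    have : ∀ i j : Fin n, (v i * v j) • (gamma n i * gamma n j) +
        (v j * v i) • (gamma n j * gamma n i) = if i = j then (v i * v j) • (-2) else 0 := by
      intro i j
      rw [mul_comm (v j), ← smul_add, gamma_anticomm]
      split_ifs <;> simp
    simp only [this, Finset.sum_ite_eq, Finset.mem_univ, if_true]
    rw [negForm, QuadraticMap.weightedSumSquares_apply, ← Finset.sum_smul, Algebra.algebraMap_eq_smul_one,
      smul_smul]
    have : (-2 : Matrix (Fin (n / 2) → Fin 2) (Fin (n / 2) → Fin 2) ℂ) = (-2 : ℝ) • 1 := by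
      rw [neg_smul, two_smul, one_add_one_eq_two]
    rw [this, smul_smul]
    congr 1
    simp
    ring
  exact smul_right_injective _ (two_ne_zero (α := ℝ)) h2

/-- The spinor representation of `Cl(ℝⁿ)` on `Δ_n`, which sends `e_i` to `gamma n i`. -/
noncomputable def cliffordRep (n : ℕ) :
    Cl n →ₐ[ℝ] Matrix (Fin (n / 2) → Fin 2) (Fin (n / 2) → Fin 2) ℂ :=
  CliffordAlgebra.lift (negForm n) ⟨Fintype.linearCombination ℝ (gamma n), gamma_vector_sq n⟩

/-! ### The antilinear structures -/

/-- `u(ε) = (1, -ε √-1) / √2`. -/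
noncomputable def u (ε : ℤˣ) : Fin 2 → ℂ :=
  fun a => (1 / (Real.sqrt 2 : ℂ)) * ![1, -(((ε : ℤ) : ℂ) * Complex.I)] a

/-- `u(ε_1, …, ε_m) = u(ε_1) ⊗ ⋯ ⊗ u(ε_m)`. -/
noncomputable def uTensor {m : ℕ} (ε : Fin m → ℤˣ) : (Fin m → Fin 2) → ℂ :=
  fun a => ∏ β, u (ε β) (a β)

theorem u_orthonormal (ε δ : ℤˣ) :
    ∑ a, starRingEnd ℂ (u ε a) * u δ a = if ε = δ then 1 else 0 := by
  have h : ((Real.sqrt 2 : ℝ) : ℂ) * ((Real.sqrt 2 : ℝ) : ℂ) = 2 := by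
    rw [← Complex.ofReal_mul, Real.mul_self_sqrt (by norm_num)]; norm_num
  have h3 : ((Real.sqrt 2 : ℝ) : ℂ)⁻¹ * ((Real.sqrt 2 : ℝ) : ℂ)⁻¹ = 1 / 2 := by
    rw [← mul_inv, h]; norm_num
  have h4 := Complex.I_mul_I
  rcases Int.units_eq_one_or ε with rfl | rfl <;> rcases Int.units_eq_one_or δ with rfl | rfl <;>
    simp [u, Fin.sum_univ_two] <;> grind

theorem uTensor_orthonormal {m : ℕ} (ε δ : Fin m → ℤˣ) :
    ∑ a, starRingEnd ℂ (uTensor ε a) * uTensor δ a = if ε = δ then 1 else 0 := by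
  simp only [uTensor, map_prod, ← Finset.prod_mul_distrib]
  have h := Finset.prod_univ_sum (fun _ : Fin m => (Finset.univ : Finset (Fin 2)))
    (fun β a => starRingEnd ℂ (u (ε β) a) * u (δ β) a)
  rw [Fintype.piFinset_univ] at h
  rw [← h]
  simp only [u_orthonormal]
  by_cases hε : ε = δ
  · subst hε
    simp
  · rw [if_neg hε]
    obtain ⟨β, hβ⟩ := Function.ne_iff.mp hε
    exact Finset.prod_eq_zero (Finset.mem_univ β) (if_neg hβ)

/-- The antilinear map of `Δ_n` with `u(ε) ↦ (√-1) ^ (w ε) u(-ε)` for every `ε`. It is defined by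
expanding a spinor in the orthonormal basis `u(ε)`. -/
noncomputable def antilinearMap (n : ℕ) (w : (Fin (n / 2) → ℤˣ) → ℤ) :
    Spinor n →ₛₗ[starRingEnd ℂ] Spinor n where
  toFun ψ := ∑ ε, (starRingEnd ℂ (∑ a, starRingEnd ℂ (uTensor ε a) * ψ a) * Complex.I ^ w ε) •
    uTensor (-ε)
  map_add' ψ φ := by
    rw [← Finset.sum_add_distrib]
    refine Finset.sum_congr rfl fun ε _ => ?_
    rw [← add_smul, ← add_mul, ← map_add, ← Finset.sum_add_distrib]
    simp [mul_add]
  map_smul' c ψ := by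
    rw [Finset.smul_sum]
    refine Finset.sum_congr rfl fun ε _ => ?_
    rw [smul_smul, ← mul_assoc, ← map_mul, Finset.mul_sum]
    simp [mul_left_comm]

theorem antilinearMap_uTensor (n : ℕ) (w : (Fin (n / 2) → ℤˣ) → ℤ) (ε : Fin (n / 2) → ℤˣ) :
    antilinearMap n w (uTensor ε) = Complex.I ^ w ε • uTensor (-ε) := by
  change ∑ δ, _ = _
  simp only [uTensor_orthonormal]
  rw [Finset.sum_eq_single ε]
  · simp
  · intro δ _ h
    simp [h]
  · simp

/-- The `j₀`-structure of `Δ_n`, with exponent `∑ α ε_α` (`1`-based `α`). -/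
noncomputable def j₀ (n : ℕ) : Spinor n →ₛₗ[starRingEnd ℂ] Spinor n :=
  antilinearMap n fun ε => ∑ α : Fin (n / 2), ((α : ℤ) + 1) * (ε α : ℤ)

/-- The `j₁`-structure of `Δ_n`, with exponent `∑ (m - α + 1) ε_α` (`1`-based `α`). -/
noncomputable def j₁ (n : ℕ) : Spinor n →ₛₗ[starRingEnd ℂ] Spinor n :=
  antilinearMap n fun ε => ∑ α : Fin (n / 2), (((n / 2 : ℕ) : ℤ) - (α : ℤ)) * (ε α : ℤ)

/-! ### The group `Spin^ℂ(n)` -/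

/-- `Spin(n)`, inside the Clifford algebra. -/
abbrev Spin (n : ℕ) : Type := spinGroup (negForm n)

/-- The subgroup `{(1, 1), (-1, -1)}` of `Spin(n) × S¹`. -/
def signSubgroup (n : ℕ) : Subgroup (Spin n × Circle) where
  carrier := {p | ((p.1 : Cl n) = 1 ∧ (p.2 : ℂ) = 1) ∨ ((p.1 : Cl n) = -1 ∧ (p.2 : ℂ) = -1)}
  one_mem' := Or.inl ⟨rfl, rfl⟩
  mul_mem' := by
    rintro ⟨a, z⟩ ⟨b, y⟩ (⟨h1, h2⟩ | ⟨h1, h2⟩) (⟨h3, h4⟩ | ⟨h3, h4⟩) <;> simp only at h1 h2 h3 h4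
    · exact Or.inl ⟨by simp [h1, h3], by simp [h2, h4]⟩
    · exact Or.inr ⟨by simp [h1, h3], by simp [h2, h4]⟩
    · exact Or.inr ⟨by simp [h1, h3], by simp [h2, h4]⟩
    · exact Or.inl ⟨by rw [Prod.fst_mul, Submonoid.coe_mul, h1, h3, neg_mul_neg, one_mul],
        by simp [h2, h4]⟩
  inv_mem' := by
    rintro ⟨a, z⟩ (⟨h1, h2⟩ | ⟨h1, h2⟩)
    · left
      have : a = 1 := Subtype.ext h1
      subst this
      simp_all
    · right
      have : a⁻¹ = a := by
        rw [inv_eq_iff_mul_eq_one]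
        exact Subtype.ext (by simp_all)
      simp_all [inv_neg]

instance signSubgroup_normal (n : ℕ) : (signSubgroup n).Normal where
  conj_mem := by
    rintro ⟨a, z⟩ (⟨h1, h2⟩ | ⟨h1, h2⟩) ⟨b, y⟩
    · have ha : a = 1 := Subtype.ext h1
      have hz : z = 1 := Subtype.ext h2
      subst ha hz
      left
      simp
    · right
      have hb : (b : Cl n) * ((b⁻¹ : Spin n) : Cl n) = 1 := congrArg Subtype.val (mul_inv_cancel b)
      simp_all

/-- `Spin^ℂ(n) = Spin(n) ⊗_{ℤ₂} S¹ = (Spin(n) × S¹) / {±(1, 1)}`. -/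
abbrev SpinC (n : ℕ) : Type := (Spin n × Circle) ⧸ signSubgroup n

namespace SpinC

variable {n : ℕ}

/-- The spinor representation of `Spin^ℂ(n)` on `Δ_n`: `a ⊗ z` acts as `z ρ(a)`. -/
noncomputable def rep (n : ℕ) :
    SpinC n →* Matrix (Fin (n / 2) → Fin 2) (Fin (n / 2) → Fin 2) ℂ :=
  QuotientGroup.lift (signSubgroup n)
    { toFun := fun p => (p.2 : ℂ) • cliffordRep n (p.1 : Cl n)
      map_one' := by simp
      map_mul' := fun p q => by
        simp only [Prod.fst_mul, Prod.snd_mul, Circle.coe_mul, Submonoid.coe_mul, map_mul,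
          smul_mul_smul_comm] }
    (by
      rintro ⟨a, z⟩ (⟨h1, h2⟩ | ⟨h1, h2⟩) <;> simp_all [MonoidHom.mem_ker])

/-- The action of `Spin^ℂ(n)` on the Clifford algebra through the covering of `SO(n)`:
`a ⊗ z` acts by `x ↦ a x a⁻¹`. -/
noncomputable def ad (n : ℕ) : SpinC n →* (Cl n →ₗ[ℝ] Cl n) :=
  QuotientGroup.lift (signSubgroup n)
    { toFun := fun p =>
        LinearMap.mulLeft ℝ (p.1 : Cl n) ∘ₗ LinearMap.mulRight ℝ ((p.1⁻¹ : Spin n) : Cl n)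
      map_one' := by ext x; simp
      map_mul' := fun p q => by
        apply LinearMap.ext
        intro x
        simp [mul_assoc] }
    (by
      rintro ⟨a, z⟩ (⟨h1, h2⟩ | ⟨h1, h2⟩)
      · have : a = 1 := Subtype.ext h1
        subst this
        rw [MonoidHom.mem_ker]
        apply LinearMap.ext
        intro x
        simp
      · have : a⁻¹ = a := by
          rw [inv_eq_iff_mul_eq_one]
          exact Subtype.ext (by simp_all)
        rw [MonoidHom.mem_ker]
        apply LinearMap.ext
        intro x
        simp_all)

/-- The homomorphism `Spin^ℂ(n) → S¹`, `a ⊗ z ↦ z²`, which gives the line bundle `L`. -/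
noncomputable def det (n : ℕ) : SpinC n →* Circle :=
  QuotientGroup.lift (signSubgroup n)
    { toFun := fun p => p.2 ^ 2
      map_one' := by simp
      map_mul' := fun p q => by simp [mul_pow] }
    (by
      rintro ⟨a, z⟩ (⟨h1, h2⟩ | ⟨h1, h2⟩) <;> rw [MonoidHom.mem_ker] <;> ext <;> simp_all)

/-- The conjugation `a ⊗ z ↦ a ⊗ z̄` of `Spin^ℂ(n)` (on `S¹` one has `z̄ = z⁻¹`). -/
noncomputable def conj (n : ℕ) : SpinC n →* SpinC n :=
  QuotientGroup.map (signSubgroup n) (signSubgroup n)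
    { toFun := fun p => (p.1, p.2⁻¹)
      map_one' := by simp
      map_mul' := fun p q => by simp [mul_comm] }
    (by
      rintro ⟨a, z⟩ (⟨h1, h2⟩ | ⟨h1, h2⟩)
      · left
        simp_all
      · right
        simp_all [inv_neg])

theorem rep_mk (p : Spin n × Circle) :
    rep n (QuotientGroup.mk p) = (p.2 : ℂ) • cliffordRep n (p.1 : Cl n) := rfl

theorem det_mk (p : Spin n × Circle) : det n (QuotientGroup.mk p) = p.2 ^ 2 := rfl

theorem conj_mk (p : Spin n × Circle) :
    conj n (QuotientGroup.mk p) = QuotientGroup.mk (p.1, p.2⁻¹) := rfl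

theorem rep_conj (g : SpinC n) :
    rep n (conj n g) = (((det n g)⁻¹ : Circle) : ℂ) • rep n g := by
  induction g using QuotientGroup.induction_on with
  | H p =>
    rw [conj_mk, rep_mk, rep_mk, det_mk, smul_smul, ← Circle.coe_mul]
    congr 2
    rw [pow_two, mul_inv, inv_mul_cancel_right]

theorem ad_conj (g : SpinC n) : ad n (conj n g) = ad n g := by
  induction g using QuotientGroup.induction_on with
  | H p => rfl

theorem det_conj (g : SpinC n) : det n (conj n g) = (det n g)⁻¹ := by
  induction g using QuotientGroup.induction_on with
  | H p =>
    rw [conj_mk, det_mk, det_mk]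
    exact inv_pow _ _

end SpinC

/-! ### `Spin^ℂ` manifolds -/

section Manifold

variable (n : ℕ) (M : Type*) [TopologicalSpace M] [ChartedSpace (EuclideanSpace ℝ (Fin n)) M]
  [IsManifold (𝓡 n) ∞ M] [RiemannianBundle (fun x : M => TangentSpace (𝓡 n) x)]

/-- A `Spin^ℂ` structure on a Riemannian `n`-manifold `M`, given by local trivializations: an open
cover `U α`, smooth orthonormal frames `E^α` of `TM` over `U α`, and smooth transition functions
`g_{αβ} : U α ∩ U β → Spin^ℂ(n)` which satisfy the cocycle condition and cover the change of
frames: if `v^α` are the coordinates of a tangent vector in `E^α`, then `v^β = g_{αβ} v^α`.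
In particular the frames differ by functions with values in `SO(n)`, so they orient `M`.
The line bundle `L` of the structure is the one with transition functions `det g_{αβ}`. -/
structure SpinCStructure (ι : Type*) where
  U : ι → Set M
  isOpen_U : ∀ α, IsOpen (U α)
  cover : ∀ x, ∃ α, x ∈ U α
  /-- The frame fields; their values outside `U α` carry no information. -/
  frame : ι → Fin n → (x : M) → TangentSpace (𝓡 n) x
  contMDiffOn_frame : ∀ α i, ContMDiffOn (𝓡 n) (𝓡 n).tangent ∞
    (fun x => (⟨x, frame α i x⟩ : TangentBundle (𝓡 n) M)) (U α)
  orthonormal_frame : ∀ α, ∀ x ∈ U α, Orthonormal ℝ (fun i => frame α i x)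
  /-- The transition functions; their values outside `U α ∩ U β` carry no information. -/
  trans : ι → ι → M → SpinC n
  /-- Smoothness into the Lie group `Spin^ℂ(n)`, expressed through its closed embedding
  `(rep, det)` into matrices. -/
  contMDiffOn_rep : ∀ α β a b, ContMDiffOn (𝓡 n) 𝓘(ℝ, ℂ) ∞
    (fun x => SpinC.rep n (trans α β x) a b) (U α ∩ U β)
  contMDiffOn_det : ∀ α β, ContMDiffOn (𝓡 n) 𝓘(ℝ, ℂ) ∞
    (fun x => (SpinC.det n (trans α β x) : ℂ)) (U α ∩ U β)
  cocycle : ∀ α β γ, ∀ x ∈ U α ∩ U β ∩ U γ, trans β γ x * trans α β x = trans α γ x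
  ad_trans : ∀ α β, ∀ x ∈ U α ∩ U β, ∀ j,
    SpinC.ad n (trans α β x) (e n j) = ∑ i, inner ℝ (frame β i x) (frame α j x) • e n i

variable {n M}

namespace SpinCStructure

variable {ι : Type*} (S : SpinCStructure n M ι)

theorem contMDiffOn_det_inv (α β : ι) : ContMDiffOn (𝓡 n) 𝓘(ℝ, ℂ) ∞
    (fun x => (((SpinC.det n (S.trans α β x))⁻¹ : Circle) : ℂ)) (S.U α ∩ S.U β) := by
  simp only [Circle.coe_inv_eq_conj]
  exact Complex.conjCLE.contDiff.contMDiff.comp_contMDiffOn (S.contMDiffOn_det α β)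

/-- The conjugate `Spin^ℂ` structure, with transition functions `f ⊗ h̄` where those of `S` are
`f ⊗ h`. Its line bundle is `-L`, the inverse of that of `S`. -/
noncomputable def conj : SpinCStructure n M ι where
  U := S.U
  isOpen_U := S.isOpen_U
  cover := S.cover
  frame := S.frame
  contMDiffOn_frame := S.contMDiffOn_frame
  orthonormal_frame := S.orthonormal_frame
  trans α β x := SpinC.conj n (S.trans α β x)
  contMDiffOn_rep α β a b := by
    simp only [SpinC.rep_conj, Matrix.smul_apply, smul_eq_mul]
    exact (contDiff_mul (𝕜 := ℝ) (𝔸 := ℂ) (n := ∞)).contMDiff.comp_contMDiffOn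
      ((S.contMDiffOn_det_inv α β).prodMk_space (S.contMDiffOn_rep α β a b))
  contMDiffOn_det α β := by
    simp only [SpinC.det_conj]
    exact S.contMDiffOn_det_inv α β
  cocycle α β γ x hx := by
    rw [← map_mul, S.cocycle α β γ x hx]
  ad_trans α β x hx j := by
    rw [SpinC.ad_conj, S.ad_trans α β x hx j]

/-- A `U(1)`-connection on the line bundle `L`: real `1`-forms `A_α` on `U α` such that
`dσ_α + √-1 A_α σ_α`, for local representatives `σ_β = det g_{αβ} σ_α` of a section of `L`, is
the local representative of its covariant derivative. -/
structure Connection where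
  /-- The local forms; their values outside `U α` carry no information. -/
  form : ι → (x : M) → TangentSpace (𝓡 n) x →L[ℝ] ℝ
  contMDiffOn_form : ∀ α i, ContMDiffOn (𝓡 n) 𝓘(ℝ, ℝ) ∞
    (fun x => form α x (S.frame α i x)) (S.U α)
  compat : ∀ α β, ∀ x ∈ S.U α ∩ S.U β, ∀ X : TangentSpace (𝓡 n) x,
    mvfderiv (𝓡 n) (fun y => (SpinC.det n (S.trans α β y) : ℂ)) x X +
      Complex.I * form β x X * SpinC.det n (S.trans α β x) =
    Complex.I * form α x X * SpinC.det n (S.trans α β x)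

/-- The connection `-A` on `-L`. -/
noncomputable def Connection.neg {S : SpinCStructure n M ι} (A : S.Connection) :
    S.conj.Connection where
  form α x := -A.form α x
  contMDiffOn_form α i := (A.contMDiffOn_form α i).neg
  compat α β x hx X := by
    have hd : MDifferentiableAt (𝓡 n) 𝓘(ℝ, ℂ)
        (fun y => (SpinC.det n (S.trans α β y) : ℂ)) x :=
      ((S.contMDiffOn_det α β).contMDiffAt
        (((S.isOpen_U α).inter (S.isOpen_U β)).mem_nhds hx)).mdifferentiableAt (by simp)
    have hf : (fun y => (SpinC.det n (S.conj.trans α β y) : ℂ)) =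
        Complex.conjCLE.toContinuousLinearMap ∘
          (fun y => (SpinC.det n (S.trans α β y) : ℂ)) := by
      funext y
      simp only [conj, SpinC.det_conj, Circle.coe_inv_eq_conj]
      rfl
    have hx' : (SpinC.det n (S.conj.trans α β x) : ℂ) =
        starRingEnd ℂ (SpinC.det n (S.trans α β x) : ℂ) := congrFun hf x
    have hc : mvfderiv (𝓡 n) (Complex.conjCLE.toContinuousLinearMap ∘
        (fun y => (SpinC.det n (S.trans α β y) : ℂ))) x X =
        starRingEnd ℂ (mvfderiv (𝓡 n) (fun y => (SpinC.det n (S.trans α β y) : ℂ)) x X) := by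
      have h := (Complex.conjCLE.toContinuousLinearMap.hasMFDerivAt
        (x := (SpinC.det n (S.trans α β x) : ℂ))).comp x hd.hasMFDerivAt
      rw [mvfderiv, h.mfderiv]
      rfl
    rw [hx', hf, hc]
    have h := congrArg (starRingEnd ℂ) (A.compat α β x hx X)
    simp only [map_add, map_mul, Complex.conj_I, Complex.conj_ofReal] at h
    simp only [neg_apply, Complex.ofReal_neg]
    linear_combination h

/-- The smooth sections of the spinor bundle `Σ(M, L)`: families of smooth functions
`s_α : U α → Δ_n` with `s_β = g_{αβ} s_α` on overlaps. Each `s_α` is extended by zero to `M`. -/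
def spinorFields : Submodule ℂ (ι → M → Spinor n) where
  carrier := {s | (∀ α, ∀ x ∉ S.U α, s α x = 0) ∧
    (∀ α, ContMDiffOn (𝓡 n) 𝓘(ℝ, Spinor n) ∞ (s α) (S.U α)) ∧
    ∀ α β, ∀ x ∈ S.U α ∩ S.U β, s β x = SpinC.rep n (S.trans α β x) *ᵥ s α x}
  zero_mem' := ⟨fun _ _ _ => rfl, fun _ => contMDiffOn_const, fun _ _ _ _ => by simp⟩
  add_mem' := by
    rintro s t ⟨h1, h2, h3⟩ ⟨k1, k2, k3⟩
    refine ⟨fun α x hx => ?_, fun α => (h2 α).add (k2 α), fun α β x hx => ?_⟩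
    · simp [h1 α x hx, k1 α x hx]
    · simp [h3 α β x hx, k3 α β x hx, Matrix.mulVec_add]
  smul_mem' := by
    rintro c s ⟨h1, h2, h3⟩
    refine ⟨fun α x hx => ?_, fun α => ?_, fun α β x hx => ?_⟩
    · simp [h1 α x hx]
    · exact (c • ContinuousLinearMap.id ℝ (Spinor n)).contDiff.contMDiff.comp_contMDiffOn (h2 α)
    · simp [h3 α β x hx, Matrix.mulVec_smul]

theorem mdifferentiableAt_spinorField (s : S.spinorFields) (α : ι) (x : M) (hx : x ∈ S.U α) :
    MDifferentiableAt (𝓡 n) 𝓘(ℝ, Spinor n) (s.1 α) x :=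
  ((s.2.2.1 α).contMDiffAt ((S.isOpen_U α).mem_nhds hx)).mdifferentiableAt (by simp)

/-- The Levi-Civita connection form `g(∇_X E_i, E_j)` of the frame `E^α`, by the Koszul formula
for orthonormal frames:
`2 g(∇_{E_k} E_i, E_j) = g([E_k, E_i], E_j) - g([E_i, E_j], E_k) + g([E_j, E_k], E_i)`. -/
noncomputable def leviCivitaForm (α : ι) (i j : Fin n) (x : M) (X : TangentSpace (𝓡 n) x) : ℝ :=
  ∑ k, inner ℝ X (S.frame α k x) * ((1 / 2) *
    (inner ℝ (VectorField.mlieBracket (𝓡 n) (S.frame α k) (S.frame α i) x) (S.frame α j x) -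
      inner ℝ (VectorField.mlieBracket (𝓡 n) (S.frame α i) (S.frame α j) x) (S.frame α k x) +
      inner ℝ (VectorField.mlieBracket (𝓡 n) (S.frame α j) (S.frame α k) x) (S.frame α i x)))

/-- `leviCivitaForm` is the connection form of the torsion-free metric connection. -/
theorem leviCivitaForm_eq [IsContMDiffRiemannianBundle (𝓡 n) 1 (EuclideanSpace ℝ (Fin n))
      (fun x : M => TangentSpace (𝓡 n) x)]
    (cov : CovariantDerivative (𝓡 n) (EuclideanSpace ℝ (Fin n))
      (fun x : M => TangentSpace (𝓡 n) x))
    (ht : cov.torsion = 0) (hm : cov.IsMetricCompatible) (α : ι) (i j : Fin n) (x : M)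
    (hx : x ∈ S.U α) (X : TangentSpace (𝓡 n) x) :
    S.leviCivitaForm α i j x X = inner ℝ (cov (S.frame α i) x X) (S.frame α j x) := by
  have hU : S.U α ∈ nhds x := (S.isOpen_U α).mem_nhds hx
  have hd : ∀ i, MDifferentiableAt (𝓡 n) (𝓡 n).tangent
      (fun x => (⟨x, S.frame α i x⟩ : TangentBundle (𝓡 n) M)) x := fun i =>
    ((S.contMDiffOn_frame α i).contMDiffAt hU).mdifferentiableAt (by simp)
  have hmet : ∀ k i j : Fin n, inner ℝ (cov (S.frame α i) x (S.frame α k x)) (S.frame α j x) +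
      inner ℝ (S.frame α i x) (cov (S.frame α j) x (S.frame α k x)) = 0 := by
    intro k i j
    have h := hm.mvfderiv_inner_eq (S.frame α k) (hd i) (hd j)
    have hc : mvfderiv (𝓡 n) (fun y => inner ℝ (S.frame α i y) (S.frame α j y)) x = 0 := by
      have he : (fun y => inner ℝ (S.frame α i y) (S.frame α j y)) =ᶠ[nhds x]
          fun _ => if i = j then (1 : ℝ) else 0 := by
        filter_upwards [hU] with y hy
        exact (orthonormal_iff_ite.mp (S.orthonormal_frame α y hy)) i j
      rw [mvfderiv, he.mfderiv_eq, mfderiv_const]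
      exact ContinuousLinearMap.comp_zero _
    rw [hc] at h
    simpa using h.symm
  have htor : ∀ i j : Fin n, VectorField.mlieBracket (𝓡 n) (S.frame α i) (S.frame α j) x =
      cov (S.frame α j) x (S.frame α i x) - cov (S.frame α i) x (S.frame α j x) := fun i j =>
    ((cov.torsion_eq_zero_iff.mp ht) (hd i) (hd j)).symm
  have hX : X = ∑ k, inner ℝ X (S.frame α k x) • S.frame α k x := by
    have hcard : Fintype.card (Fin n) = Module.finrank ℝ (TangentSpace (𝓡 n) x) := by
      change _ = Module.finrank ℝ (EuclideanSpace ℝ (Fin n))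
      simp
    have ho := S.orthonormal_frame α x hx
    have hs : (⊤ : Submodule ℝ (TangentSpace (𝓡 n) x)) ≤
        Submodule.span ℝ (Set.range fun k => S.frame α k x) := by
      have : FiniteDimensional ℝ (TangentSpace (𝓡 n) x) :=
        inferInstanceAs (FiniteDimensional ℝ (EuclideanSpace ℝ (Fin n)))
      exact (ho.linearIndependent.span_eq_top_of_card_eq_finrank' hcard).ge
    have h := (OrthonormalBasis.mk ho hs).sum_repr' X
    simp only [OrthonormalBasis.coe_mk] at h
    conv_lhs => rw [← h]
    exact Finset.sum_congr rfl fun k _ => by rw [real_inner_comm]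
  conv_rhs => rw [hX]
  rw [map_sum, sum_inner, leviCivitaForm]
  refine Finset.sum_congr rfl fun k _ => ?_
  rw [map_smul, real_inner_smul_left]
  congr 1
  simp only [htor, inner_sub_left]
  have h1 := hmet k i j
  have h2 := hmet i j k
  have h3 := hmet j k i
  rw [real_inner_comm (cov (S.frame α j) x (S.frame α k x))] at h1
  rw [real_inner_comm (cov (S.frame α k) x (S.frame α i x))] at h2
  rw [real_inner_comm (cov (S.frame α i) x (S.frame α j x))] at h3
  linarith

/-- The spinor derivative `∇^A_X s` in the trivialization over `U α`:
`X(s) + ½ (√-1 A(X) + ∑_{i<j} g(∇_X E_i, E_j) e_i e_j) s`. -/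
noncomputable def spinorDeriv (A : S.Connection) (s : ι → M → Spinor n) (α : ι) (x : M)
    (X : TangentSpace (𝓡 n) x) : Spinor n :=
  mvfderiv (𝓡 n) (s α) x X +
    (1 / 2 : ℂ) • ((Complex.I * (A.form α x X : ℂ)) • s α x +
      ∑ i, ∑ j ∈ Finset.Ioi i,
        (S.leviCivitaForm α i j x X : ℂ) • ((gamma n i * gamma n j) *ᵥ s α x))

/-- The `Spin^ℂ` Dirac operator `D^A s = ∑ E_k · ∇^A_{E_k} s`, as a family of functions on the
sets `U α`, extended by zero. -/
noncomputable def dirac (A : S.Connection) : S.spinorFields →ₗ[ℂ] (ι → M → Spinor n) where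
  toFun s α := (S.U α).indicator fun x =>
    ∑ k, gamma n k *ᵥ S.spinorDeriv A s.1 α x (S.frame α k x)
  map_add' s t := by
    funext α x
    by_cases hx : x ∈ S.U α
    · have hd : ∀ X, S.spinorDeriv A (s.1 + t.1) α x X =
          S.spinorDeriv A s.1 α x X + S.spinorDeriv A t.1 α x X := by
        intro X
        have hX : mvfderiv (𝓡 n) (s.1 α + t.1 α) x X =
            mvfderiv (𝓡 n) (s.1 α) x X + mvfderiv (𝓡 n) (t.1 α) x X := by
          rw [mvfderiv_add (S.mdifferentiableAt_spinorField s α x hx)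
            (S.mdifferentiableAt_spinorField t α x hx)]
          rfl
        simp only [spinorDeriv, Pi.add_apply, hX, Matrix.mulVec_add, smul_add,
          Finset.sum_add_distrib]
        abel
      simp [Set.indicator_of_mem hx, hd, Matrix.mulVec_add, Finset.sum_add_distrib]
    · simp [Set.indicator_of_notMem hx]
  map_smul' c s := by
    funext α x
    by_cases hx : x ∈ S.U α
    · have h := ((c • ContinuousLinearMap.id ℝ (Spinor n)).hasMFDerivAt (x := s.1 α x)).comp x
        (S.mdifferentiableAt_spinorField s α x hx).hasMFDerivAt
      have hd : ∀ X, S.spinorDeriv A (c • s.1) α x X = c • S.spinorDeriv A s.1 α x X := by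
        intro X
        have hX : mvfderiv (𝓡 n) (c • s.1 α) x X = c • mvfderiv (𝓡 n) (s.1 α) x X := by
          have h' : mfderiv (𝓡 n) 𝓘(ℝ, Spinor n) (c • s.1 α) x = _ := h.mfderiv
          rw [mvfderiv, h']
          rfl
        simp only [spinorDeriv, Pi.smul_apply, hX, Matrix.mulVec_smul, smul_add,
          Finset.smul_sum, smul_comm c]
      simp [Set.indicator_of_mem hx, hd, Matrix.mulVec_smul, Finset.smul_sum]
    · simp [Set.indicator_of_notMem hx]

/-- The space of smooth `s` with `D^A s = lam s`. -/
noncomputable def eigenspace (A : S.Connection) (lam : ℂ) : Submodule ℂ S.spinorFields :=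
  LinearMap.ker (S.dirac A - lam • S.spinorFields.subtype)

/-- The spectrum of `D^A` on a closed manifold: its (real) eigenvalues. -/
def spec (A : S.Connection) : Set ℝ :=
  {lam | S.eigenspace A (lam : ℂ) ≠ ⊥}

/-- The multiplicity of a real number as an eigenvalue of `D^A`. -/
noncomputable def multiplicity (A : S.Connection) (lam : ℝ) : Cardinal :=
  Module.rank ℂ (S.eigenspace A (lam : ℂ))

end SpinCStructure

/-- The fibrewise action of an antilinear map of `Δ_n` on families of local spinors. -/
def onFields {n : ℕ} {M ι : Type*} (j : Spinor n →ₛₗ[starRingEnd ℂ] Spinor n) :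
    (ι → M → Spinor n) →ₛₗ[starRingEnd ℂ] (ι → M → Spinor n) where
  toFun s α x := j (s α x)
  map_add' s t := by
    funext α x
    simp
  map_smul' c s := by
    funext α x
    simp

end Manifold

end SpinCDirac

namespace SpinCDirac

/-! ### Tensor products of vectors and matrices -/

/-! Everything follows from one pointwise property, `CliffordTwist`: an antilinear `J` with `J e_k =
c e_k J` for all `k` and `c = ±1`. Products of two vectors then commute with `J`, hence so does
`Spin(n)`, while antilinearity turns `z` into `z̄`; so `J` carries sections of `Σ(M, L)` to sections
of `Σ(M, -L)` (`map_rep`). In the covariant derivative only the term `√-1 A` changes sign, so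
`∇^{-A} J = J ∇^A`, and the single vector left in `D` contributes `c` (`dirac_onFields`).

The sign is computed in the basis `u(ε)`, where `T` is diagonal with eigenvalue `-ε` and `g₁`, `g₂`
flip `ε`. For the exponent `∑ p_β ε_β`, each `T` gives `-1` and a `g₁` or `g₂` in position `i`
(counted from `0`) gives `-(-1)^{p_i}`; thus `c = (-1)^{i + 1 + p_i}` must not depend on `i`. If `n`
is odd, `e_{2m+1}` also requires `c = (-1)^{m+1}`. With `p_i = i + 1` this means `c = 1`, and `m`
odd when `n` is odd; with `p_i = m - i` it always gives `c = (-1)^{m+1}`.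

For the spectra, the square of `j₁` is a nonzero scalar, so `j₁` is a conjugate-linear bijection
from the `λ`-eigenspace of `D^A` to the `cλ`-eigenspace of `D^{-A}` (`eigenspaceEquiv`). -/

theorem tensorMatrix_mulVec {m : ℕ} (M : Fin m → Matrix (Fin 2) (Fin 2) ℂ)
    (v : Fin m → Fin 2 → ℂ) :
    tensorMatrix M *ᵥ (fun a => ∏ β, v β (a β)) = fun a => ∏ β, (M β *ᵥ v β) (a β) := by
  funext a
  simp only [Matrix.mulVec, dotProduct, tensorMatrix, Matrix.of_apply, ← Finset.prod_mul_distrib]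
  rw [Finset.prod_univ_sum, Fintype.piFinset_univ]

theorem tensorMatrix_mulVec_uTensor {m : ℕ} (M : Fin m → Matrix (Fin 2) (Fin 2) ℂ)
    (a : Fin m → ℂ) (ε δ : Fin m → ℤˣ) (h : ∀ β, M β *ᵥ u (ε β) = a β • u (δ β)) :
    tensorMatrix M *ᵥ uTensor ε = (∏ β, a β) • uTensor δ := by
  have h' := tensorMatrix_mulVec M (fun β => u (ε β))
  unfold uTensor
  rw [h']
  funext x
  simp [h, Finset.prod_mul_distrib]

theorem g₁_mulVec_u (ε : ℤˣ) : g₁ *ᵥ u ε = Complex.I • u (-ε) := by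
  funext a
  fin_cases a <;> rcases Int.units_eq_one_or ε with rfl | rfl <;>
    simp [g₁, u, Matrix.mulVec, dotProduct, Fin.sum_univ_two]

theorem g₂_mulVec_u (ε : ℤˣ) : g₂ *ᵥ u ε = ((ε : ℤ) : ℂ) • u (-ε) := by
  funext a
  have := Complex.I_mul_I
  fin_cases a <;> rcases Int.units_eq_one_or ε with rfl | rfl <;>
    simp [g₂, u, Matrix.mulVec, dotProduct, Fin.sum_univ_two] <;> grind

theorem T_mulVec_u (ε : ℤˣ) : T *ᵥ u ε = (-((ε : ℤ) : ℂ)) • u ε := by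
  funext a
  have := Complex.I_mul_I
  fin_cases a <;> rcases Int.units_eq_one_or ε with rfl | rfl <;>
    simp [T, u, Matrix.mulVec, dotProduct, Fin.sum_univ_two] <;> grind

/-! ### The basis `u(ε)` -/

/-- Orthonormality gives a one-sided matrix inverse. Both index sets have `2 ^ m` elements, so it is
two-sided, which is completeness of the basis. -/
theorem uTensor_expansion {n : ℕ} (ψ : Spinor n) :
    ψ = ∑ ε : Fin (n / 2) → ℤˣ,
      (∑ a, starRingEnd ℂ (uTensor ε a) * ψ a) • uTensor ε := by
  let U : Matrix (Fin (n / 2) → ℤˣ) (Fin (n / 2) → Fin 2) ℂ :=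
    Matrix.of fun ε a => starRingEnd ℂ (uTensor ε a)
  let V : Matrix (Fin (n / 2) → Fin 2) (Fin (n / 2) → ℤˣ) ℂ := Matrix.of fun a ε => uTensor ε a
  have hUV : U * V = 1 := by
    ext ε δ
    simp only [U, V, Matrix.mul_apply, Matrix.of_apply, Matrix.one_apply, uTensor_orthonormal]
  have hVU : V * U = 1 :=
    (Matrix.mul_eq_one_comm_of_equiv
      (Fintype.equivOfCardEq (by simp [Fintype.card_units_int]))).mp hUV
  have h : V *ᵥ (U *ᵥ ψ) = ψ := by rw [Matrix.mulVec_mulVec, hVU, Matrix.one_mulVec]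
  conv_lhs => rw [← h]
  funext a
  simp only [U, V, Matrix.mulVec, dotProduct, Matrix.of_apply, Finset.sum_apply, Pi.smul_apply,
    smul_eq_mul, mul_comm]

theorem semilinear_ext_uTensor {n : ℕ} {σ : ℂ →+* ℂ} {f g : Spinor n →ₛₗ[σ] Spinor n}
    (h : ∀ ε, f (uTensor ε) = g (uTensor ε)) : f = g := by
  ext1 ψ
  rw [uTensor_expansion ψ]
  simp only [map_sum, map_smulₛₗ, h]

/-! ### Antilinear maps and Clifford multiplication -/

/-- `J` commutes with Clifford multiplication by vectors up to the factor `c`. -/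
def CliffordTwist {n : ℕ} (J : Spinor n →ₛₗ[starRingEnd ℂ] Spinor n) (c : ℂ) : Prop :=
  ∀ (k : Fin n) (v : Spinor n), J (gamma n k *ᵥ v) = c • gamma n k *ᵥ J v

/-- The antilinear map whose exponent is the linear form `∑ p_β ε_β`. -/
noncomputable def weightedMap (n : ℕ) (p : Fin (n / 2) → ℤ) :
    Spinor n →ₛₗ[starRingEnd ℂ] Spinor n :=
  antilinearMap n fun ε => ∑ β, p β * (ε β : ℤ)

theorem I_zpow_sum {m : ℕ} (p : Fin m → ℤ) (ε : Fin m → ℤˣ) :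
    Complex.I ^ (∑ β, p β * (ε β : ℤ)) = ∏ β, Complex.I ^ (p β * (ε β : ℤ)) := by
  induction m with
  | zero => simp
  | succ m ih =>
    rw [Fin.sum_univ_succ, Fin.prod_univ_succ, zpow_add₀ Complex.I_ne_zero,
      ih (fun β => p β.succ) (fun β => ε β.succ)]

theorem weightedMap_uTensor (n : ℕ) (p : Fin (n / 2) → ℤ) (ε : Fin (n / 2) → ℤˣ) :
    weightedMap n p (uTensor ε) = (∏ β, Complex.I ^ (p β * (ε β : ℤ))) • uTensor (-ε) := by
  rw [weightedMap, antilinearMap_uTensor, I_zpow_sum]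

/-- Both sides send a basis vector to multiples of the same basis vector, and the coefficients
factor over tensor positions. Commutation up to a scalar thus reduces to the scalar identity `hr` in
each position. -/
theorem weightedMap_tensorMatrix {n : ℕ} (p : Fin (n / 2) → ℤ)
    (M : Fin (n / 2) → Matrix (Fin 2) (Fin 2) ℂ) (a : Fin (n / 2) → ℤˣ → ℂ)
    (s : Fin (n / 2) → ℤˣ) (r : Fin (n / 2) → ℂ)
    (hM : ∀ β ε, M β *ᵥ u ε = a β ε • u (s β * ε))
    (hr : ∀ β (ε : ℤˣ), starRingEnd ℂ (a β ε) * Complex.I ^ (p β * ((s β * ε : ℤˣ) : ℤ)) =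
      r β * (Complex.I ^ (p β * (ε : ℤ)) * a β (-ε))) (v : Spinor n) :
    weightedMap n p (tensorMatrix M *ᵥ v) = (∏ β, r β) • tensorMatrix M *ᵥ weightedMap n p v := by
  have h : (weightedMap n p).comp (tensorMatrix M).mulVecLin =
      (∏ β, r β) • (tensorMatrix M).mulVecLin.comp (weightedMap n p) := by
    refine semilinear_ext_uTensor fun ε => ?_
    simp only [LinearMap.comp_apply, LinearMap.smul_apply, Matrix.mulVecLin_apply]
    rw [tensorMatrix_mulVec_uTensor M (fun β => a β (ε β)) ε (s * ε) fun β => hM β (ε β),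
      map_smulₛₗ, weightedMap_uTensor, weightedMap_uTensor, Matrix.mulVec_smul,
      tensorMatrix_mulVec_uTensor M (fun β => a β (-ε β)) (-ε) (-(s * ε)) fun β => by
        simp [hM], smul_smul, smul_smul, smul_smul, map_prod, ← Finset.prod_mul_distrib,
      ← Finset.prod_mul_distrib, ← Finset.prod_mul_distrib]
    congr 1
    exact Finset.prod_congr rfl fun β _ => by rw [mul_assoc]; exact hr β (ε β)
  exact congrArg (fun f => f v) h

/-- The quotient of the two powers of `√-1` is `(-1)^{pε}`, and the sign `ε` does not affect the
parity of the exponent. -/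
theorem I_zpow_mul_neg (p : ℤ) (ε : ℤˣ) :
    Complex.I ^ (-(p * (ε : ℤ))) = (-1 : ℂ) ^ p * Complex.I ^ (p * (ε : ℤ)) := by
  have h : (-1 : ℂ) ^ p = Complex.I ^ (2 * p) := by
    rw [zpow_mul]
    norm_num
  have h' : (-1 : ℂ) ^ p = Complex.I ^ (-(2 * p)) := by
    rw [zpow_neg, ← h, ← inv_zpow]
    norm_num
  rcases Int.units_eq_one_or ε with rfl | rfl
  · rw [h', ← zpow_add₀ Complex.I_ne_zero]
    congr 1
    push_cast
    ring
  · rw [h, ← zpow_add₀ Complex.I_ne_zero]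
    congr 1
    push_cast
    ring

theorem prod_position {m i : ℕ} (hi : i < m) (q : ℂ) :
    ∏ β : Fin m, (if (β : ℕ) < i then -1 else if (β : ℕ) = i then q else 1) = (-1) ^ i * q := by
  induction m generalizing i with
  | zero => omega
  | succ m ih =>
    rw [Fin.prod_univ_succ]
    rcases i with _ | i
    · simp
    · have := ih (i := i) (by omega)
      simp only [Fin.val_succ, Fin.val_zero, Nat.add_lt_add_iff_right, Nat.add_right_cancel_iff]
      rw [this]
      simp [pow_succ]

theorem weightedMap_T (n : ℕ) (p : Fin (n / 2) → ℤ) (v : Spinor n) :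
    weightedMap n p (tensorMatrix (fun _ => T) *ᵥ v) =
      (-1 : ℂ) ^ (n / 2) • tensorMatrix (fun _ => T) *ᵥ weightedMap n p v := by
  rw [weightedMap_tensorMatrix p (fun _ => T) (fun _ ε => -((ε : ℤ) : ℂ)) 1 (fun _ => -1)
    (fun β ε => by simpa using T_mulVec_u ε) (fun β ε => by simp [mul_comm])]
  simp

theorem weightedMap_gammaFactor (n : ℕ) (p : Fin (n / 2) → ℤ) (k : ℕ) (hk : k / 2 < n / 2)
    (v : Spinor n) :
    weightedMap n p (tensorMatrix (fun β => gammaFactor k β) *ᵥ v) =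
      ((-1 : ℂ) ^ (k / 2) * -(-1) ^ p ⟨k / 2, hk⟩) •
        tensorMatrix (fun β => gammaFactor k β) *ᵥ weightedMap n p v := by
  -- The arguments are the coefficients on `u(ε)`, the flip of `ε` (only in position `k / 2`), and
  -- the resulting signs. For `g₁` the sign comes from conjugating `√-1`; for `g₂`, from its
  -- coefficient `ε` being odd.
  rw [weightedMap_tensorMatrix p (fun β => gammaFactor k β)
    (fun β ε => if (β : ℕ) < k / 2 then -((ε : ℤ) : ℂ)
      else if (β : ℕ) = k / 2 then (if k % 2 = 0 then Complex.I else ((ε : ℤ) : ℂ)) else 1)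
    (fun β => if (β : ℕ) = k / 2 then -1 else 1)
    (fun β => if (β : ℕ) < k / 2 then -1
      else if (β : ℕ) = k / 2 then -(-1) ^ p ⟨k / 2, hk⟩ else 1), prod_position hk]
  · intro β ε
    unfold gammaFactor
    split_ifs <;> first
      | omega
      | simp only [T_mulVec_u, g₁_mulVec_u, g₂_mulVec_u, Matrix.one_mulVec, one_mul, one_smul,
          neg_one_mul]
  · intro β ε
    by_cases h1 : (β : ℕ) < k / 2
    · simp [h1, h1.ne, mul_comm]
    · by_cases h2 : (β : ℕ) = k / 2
      · have h3 : p ⟨k / 2, hk⟩ = p β := congrArg p (Fin.ext h2.symm)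
        have h4 := I_zpow_mul_neg (p β) ε
        simp only [if_neg h1, if_pos h2, h3]
        have h5 : p β * ((-1 * ε : ℤˣ) : ℤ) = -(p β * (ε : ℤ)) := by simp
        rw [h5, h4]
        split_ifs
        · rw [Complex.conj_I]
          ring
        · rw [map_intCast, Units.val_neg, Int.cast_neg]
          ring
      · simp [h1, h2]

/-- `hc` handles the first `2m` basis vectors. `hodd` handles `e_{2m+1} = √-1 T ⊗ ⋯ ⊗ T`: `m` signs
from the factors `T` and one from conjugating `√-1`. -/
theorem weightedMap_cliffordTwist (n : ℕ) (p : Fin (n / 2) → ℤ) (c : ℂ)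
    (hc : ∀ β : Fin (n / 2), (-1 : ℂ) ^ (β : ℕ) * -(-1) ^ p β = c)
    (hodd : n % 2 = 1 → (-1 : ℂ) ^ (n / 2 + 1) = c) : CliffordTwist (weightedMap n p) c := by
  intro k v
  unfold gamma
  split_ifs with h
  · rw [weightedMap_gammaFactor n p k (by omega), ← hc ⟨(k : ℕ) / 2, by omega⟩]
  · rw [Matrix.smul_mulVec, Matrix.smul_mulVec, map_smulₛₗ, weightedMap_T, ← hodd (by omega)]
    simp only [smul_smul, Complex.conj_I]
    congr 1
    ring

theorem j₀_cliffordTwist {n : ℕ} (h : ¬ n ≡ 1 [MOD 4]) : CliffordTwist (j₀ n) 1 := by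
  refine weightedMap_cliffordTwist n (fun α => (α : ℤ) + 1) 1 (fun β => ?_) fun hn => ?_
  · have h2 : ((β : ℕ) : ℤ) + 1 = ((β + 1 : ℕ) : ℤ) := by push_cast; ring
    rw [h2, zpow_natCast, pow_succ]
    rw [mul_neg, mul_neg_one, mul_neg, neg_neg, ← mul_pow]
    norm_num
  -- An odd `n` not congruent to `1` modulo `4` has the form `4q + 3`, so `m` is odd.
  · refine Even.neg_one_pow ?_
    unfold Nat.ModEq at h
    rw [Nat.even_iff]
    omega

theorem j₁_cliffordTwist (n : ℕ) : CliffordTwist (j₁ n) ((-1) ^ (n / 2 + 1)) := by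
  refine weightedMap_cliffordTwist n (fun α => ((n / 2 : ℕ) : ℤ) - (α : ℤ)) _ (fun β => ?_)
    fun _ => rfl
  have h2 : ((n / 2 : ℕ) : ℤ) - (β : ℤ) = ((n / 2 - β : ℕ) : ℤ) := by
    rw [Nat.cast_sub β.2.le]
  rw [h2, zpow_natCast, mul_neg, ← pow_add, Nat.add_sub_cancel' β.2.le, pow_succ, mul_neg_one]

theorem weightedMap_weightedMap (n : ℕ) (p : Fin (n / 2) → ℤ) (v : Spinor n) :
    weightedMap n p (weightedMap n p v) = (∏ β, (-1 : ℂ) ^ p β) • v := by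
  have h : (weightedMap n p).comp (weightedMap n p) = (∏ β, (-1 : ℂ) ^ p β) • LinearMap.id := by
    refine semilinear_ext_uTensor fun ε => ?_
    simp only [LinearMap.comp_apply, LinearMap.smul_apply, LinearMap.id_apply]
    rw [weightedMap_uTensor, map_smulₛₗ, weightedMap_uTensor, neg_neg, smul_smul, map_prod,
      ← Finset.prod_mul_distrib]
    congr 1
    refine Finset.prod_congr rfl fun β _ => ?_
    have h1 : p β * (((-ε) β : ℤˣ) : ℤ) = -(p β * (ε β : ℤ)) := by simp
    rw [h1, I_zpow_mul_neg, map_zpow₀, Complex.conj_I, ← mul_assoc, mul_comm (_ ^ _), mul_assoc,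
      ← mul_zpow]
    simp
  exact congrArg (fun f => f v) h

theorem j₁_involutive_up_to_sign (n : ℕ) :
    ∃ d : ℂ, d ≠ 0 ∧ ∀ v, j₁ n (j₁ n v) = d • v :=
  ⟨_, Finset.prod_ne_zero_iff.mpr fun _ _ => zpow_ne_zero _ (neg_ne_zero.mpr one_ne_zero),
    weightedMap_weightedMap n _⟩

/-! ### Compatibility with the even Clifford algebra and `Spin^ℂ(n)` -/

namespace CliffordTwist

variable {n : ℕ} {J : Spinor n →ₛₗ[starRingEnd ℂ] Spinor n} {c : ℂ}

theorem gamma_mul_gamma (h : CliffordTwist J c) (hc : c * c = 1) (i j : Fin n) (v : Spinor n) :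
    J ((gamma n i * gamma n j) *ᵥ v) = (gamma n i * gamma n j) *ᵥ J v := by
  rw [← Matrix.mulVec_mulVec, h, h, Matrix.mulVec_smul, smul_smul, hc, one_smul,
    Matrix.mulVec_mulVec]

theorem map_real_smul (J : Spinor n →ₛₗ[starRingEnd ℂ] Spinor n) (r : ℝ) (v : Spinor n) :
    J (r • v) = r • J v := by
  have h (w : Spinor n) : r • w = (r : ℂ) • w := by ext; simp
  rw [h, h, map_smulₛₗ, Complex.conj_ofReal]

theorem map_cliffordRep_ι (h : CliffordTwist J c) (w : Fin n → ℝ) (v : Spinor n) :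
    J (cliffordRep n (CliffordAlgebra.ι (negForm n) w) *ᵥ v) =
      c • cliffordRep n (CliffordAlgebra.ι (negForm n) w) *ᵥ J v := by
  rw [cliffordRep, CliffordAlgebra.lift_ι_apply]
  simp only [Fintype.linearCombination_apply, Matrix.sum_mulVec, map_sum, Matrix.smul_mulVec,
    map_real_smul, h _ _, Finset.smul_sum]
  exact Finset.sum_congr rfl fun i _ => smul_comm _ _ _

/-- The even subalgebra is built from products of pairs of vectors, and each pair contributes `c * c
= 1`. -/
theorem map_cliffordRep_even (h : CliffordTwist J c) (hc : c * c = 1) (x : Cl n)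
    (hx : x ∈ CliffordAlgebra.even (negForm n)) (v : Spinor n) :
    J (cliffordRep n x *ᵥ v) = cliffordRep n x *ᵥ J v := by
  induction x, hx using CliffordAlgebra.even_induction with
  | algebraMap r =>
    rw [AlgHom.commutes, Algebra.algebraMap_eq_smul_one, Matrix.smul_mulVec, Matrix.smul_mulVec,
      map_real_smul, Matrix.one_mulVec, Matrix.one_mulVec]
  | add x y _ _ hx hy => rw [map_add, Matrix.add_mulVec, map_add, hx, hy, Matrix.add_mulVec]
  | ι_mul_ι_mul a b x _ hx =>
    rw [map_mul, map_mul, ← Matrix.mulVec_mulVec, ← Matrix.mulVec_mulVec, h.map_cliffordRep_ι,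
      h.map_cliffordRep_ι, hx, Matrix.mulVec_smul, smul_smul, hc, one_smul, Matrix.mulVec_mulVec,
      Matrix.mulVec_mulVec]

theorem map_rep (h : CliffordTwist J c) (hc : c * c = 1) (g : SpinC n) (v : Spinor n) :
    J (SpinC.rep n g *ᵥ v) = SpinC.rep n (SpinC.conj n g) *ᵥ J v := by
  induction g using QuotientGroup.induction_on with
  | H p =>
    rw [SpinC.conj_mk, SpinC.rep_mk, SpinC.rep_mk, Matrix.smul_mulVec, Matrix.smul_mulVec,
      map_smulₛₗ, h.map_cliffordRep_even hc _ (spinGroup.mem_even p.1.2), Circle.coe_inv_eq_conj]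

end CliffordTwist

theorem SpinC.conj_conj {n : ℕ} (g : SpinC n) : SpinC.conj n (SpinC.conj n g) = g := by
  induction g using QuotientGroup.induction_on with
  | H p => rw [SpinC.conj_mk, SpinC.conj_mk, inv_inv]

/-! ### The action on spinor fields and the Dirac operator -/

/-- An antilinear map of `Δ_n` as a continuous real-linear map. -/
noncomputable def realMap {n : ℕ} (J : Spinor n →ₛₗ[starRingEnd ℂ] Spinor n) :
    Spinor n →L[ℝ] Spinor n :=
  LinearMap.toContinuousLinearMap
    { toFun := J
      map_add' := map_add J
      map_smul' := CliffordTwist.map_real_smul J }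

section Families

variable {n : ℕ} {M ι : Type*} {J : Spinor n →ₛₗ[starRingEnd ℂ] Spinor n} {d : ℂ}

theorem onFields_apply (s : ι → M → Spinor n) (α : ι) (x : M) : onFields J s α x = J (s α x) := rfl

theorem injective_of_sq (hd : d ≠ 0) (hJ : ∀ v, J (J v) = d • v) : Function.Injective J := by
  intro v w hvw
  have h := congrArg J hvw
  rw [hJ, hJ] at h
  exact smul_right_injective _ hd h

theorem onFields_injective (hd : d ≠ 0) (hJ : ∀ v, J (J v) = d • v) :
    Function.Injective (onFields (M := M) (ι := ι) J) := by
  intro s t hst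
  funext α x
  exact injective_of_sq hd hJ (congrFun (congrFun hst α) x)

theorem contMDiffOn_onFields [TopologicalSpace M]
    [ChartedSpace (EuclideanSpace ℝ (Fin n)) M] {s : ι → M → Spinor n} {U : Set M} {α : ι}
    (h : ContMDiffOn (𝓡 n) 𝓘(ℝ, Spinor n) ∞ (s α) U) :
    ContMDiffOn (𝓡 n) 𝓘(ℝ, Spinor n) ∞ (onFields J s α) U :=
  (realMap J).contDiff.contMDiff.comp_contMDiffOn h

end Families

section Fields

variable {n : ℕ} {M : Type*} [TopologicalSpace M] [ChartedSpace (EuclideanSpace ℝ (Fin n)) M]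
  [IsManifold (𝓡 n) ∞ M] [RiemannianBundle (fun x : M => TangentSpace (𝓡 n) x)]
  {ι : Type*} {S : SpinCStructure n M ι} {J : Spinor n →ₛₗ[starRingEnd ℂ] Spinor n} {c d : ℂ}

namespace SpinCStructure

theorem dirac_apply_of_mem (S : SpinCStructure n M ι) (A : S.Connection) (s : S.spinorFields)
    {α : ι} {x : M} (hx : x ∈ S.U α) :
    S.dirac A s α x = ∑ k, gamma n k *ᵥ S.spinorDeriv A s.1 α x (S.frame α k x) :=
  Set.indicator_of_mem hx (fun y => ∑ k, gamma n k *ᵥ S.spinorDeriv A s.1 α y (S.frame α k y))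

theorem dirac_apply_of_notMem (S : SpinCStructure n M ι) (A : S.Connection) (s : S.spinorFields)
    {α : ι} {x : M} (hx : x ∉ S.U α) : S.dirac A s α x = 0 :=
  Set.indicator_of_notMem hx
    (fun y => ∑ k, gamma n k *ᵥ S.spinorDeriv A s.1 α y (S.frame α k y))

theorem mem_eigenspace {A : S.Connection} {lam : ℂ} {s : S.spinorFields} :
    s ∈ S.eigenspace A lam ↔ S.dirac A s = lam • s.1 := by
  rw [eigenspace, LinearMap.mem_ker, LinearMap.sub_apply, sub_eq_zero]
  rfl

end SpinCStructure

namespace CliffordTwist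

theorem onFields_mem_conj (h : CliffordTwist J c) (hc : c * c = 1) {s : ι → M → Spinor n}
    (hs : s ∈ S.spinorFields) : onFields J s ∈ S.conj.spinorFields := by
  obtain ⟨h1, h2, h3⟩ := hs
  refine ⟨fun α x hx => ?_, fun α => contMDiffOn_onFields (h2 α), fun α β x hx => ?_⟩
  · exact (congrArg J (h1 α x hx)).trans (map_zero J)
  · exact (congrArg J (h3 α β x hx)).trans (h.map_rep hc _ _)

/-- Conjugating the transition functions twice restores them, so `J` also maps back; this supplies
preimages for the eigenspace bijection. -/
theorem onFields_mem_of_conj (h : CliffordTwist J c) (hc : c * c = 1) {s : ι → M → Spinor n}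
    (hs : s ∈ S.conj.spinorFields) : onFields J s ∈ S.spinorFields := by
  obtain ⟨h1, h2, h3⟩ := hs
  refine ⟨fun α x hx => ?_, fun α => contMDiffOn_onFields (h2 α), fun α β x hx => ?_⟩
  · exact (congrArg J (h1 α x hx)).trans (map_zero J)
  · refine (congrArg J (h3 α β x hx)).trans ((h.map_rep hc _ _).trans ?_)
    simp only [SpinCStructure.conj, SpinC.conj_conj]
    rfl

theorem mvfderiv_onFields (s : S.spinorFields) (α : ι) (x : M) (hx : x ∈ S.U α)
    (X : TangentSpace (𝓡 n) x) :
    mvfderiv (𝓡 n) (onFields J s.1 α) x X = J (mvfderiv (𝓡 n) (s.1 α) x X) := by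
  have h := ((realMap J).hasMFDerivAt (x := s.1 α x)).comp x
    (S.mdifferentiableAt_spinorField s α x hx).hasMFDerivAt
  have h' : mfderiv (𝓡 n) 𝓘(ℝ, Spinor n) (onFields J s.1 α) x = _ := h.mfderiv
  rw [mvfderiv, h']
  rfl

/-- `J` is constant and real-linear, so it commutes with `X(s)`; the connection form is real and the
`e_i e_j` commute with `J`. The sign from conjugating `√-1` is absorbed by replacing `A` with `-A`.
-/
theorem spinorDeriv_onFields (h : CliffordTwist J c) (hc : c * c = 1) (A : S.Connection)
    (s : S.spinorFields) (α : ι) (x : M) (hx : x ∈ S.U α) (X : TangentSpace (𝓡 n) x) :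
    S.conj.spinorDeriv A.neg (onFields J s.1) α x X = J (S.spinorDeriv A s.1 α x X) := by
  have hJ : onFields J s.1 α x = J (s.1 α x) := rfl
  have hA : A.neg.form α x X = -A.form α x X := rfl
  have hL : ∀ i j, S.conj.leviCivitaForm α i j x X = S.leviCivitaForm α i j x X := fun _ _ => rfl
  rw [SpinCStructure.spinorDeriv, mvfderiv_onFields s α x hx]
  simp only [SpinCStructure.spinorDeriv, hJ, hA, hL, map_add, map_sum, map_smulₛₗ,
    h.gamma_mul_gamma hc, map_mul, Complex.conj_I, Complex.conj_ofReal, Complex.ofReal_neg,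
    map_div₀, map_one, map_ofNat, mul_neg, neg_mul]

theorem dirac_onFields (h : CliffordTwist J c) (hc : c * c = 1) (A : S.Connection)
    (s : S.spinorFields) :
    S.conj.dirac A.neg ⟨_, h.onFields_mem_conj hc s.2⟩ = c • onFields J (S.dirac A s) := by
  funext α x
  rw [Pi.smul_apply, Pi.smul_apply, onFields_apply]
  by_cases hx : x ∈ S.U α
  · rw [S.dirac_apply_of_mem A s hx, S.conj.dirac_apply_of_mem A.neg _ hx, map_sum,
      Finset.smul_sum]
    refine Finset.sum_congr rfl fun k _ => ?_
    rw [h, smul_smul, hc, one_smul, h.spinorDeriv_onFields hc A s α x hx]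
    rfl
  · rw [S.dirac_apply_of_notMem A s hx, S.conj.dirac_apply_of_notMem A.neg _ hx, map_zero,
      smul_zero]

/-! ### Eigenspaces, multiplicities and spectra -/

theorem onFields_mem_eigenspace (h : CliffordTwist J c) (hc : c * c = 1) (A : S.Connection)
    {lam mu : ℝ} (hmu : (mu : ℂ) = c * lam) (s : S.spinorFields)
    (hs : s ∈ S.eigenspace A lam) :
    (⟨_, h.onFields_mem_conj hc s.2⟩ : S.conj.spinorFields) ∈ S.conj.eigenspace A.neg mu := by
  rw [SpinCStructure.mem_eigenspace] at hs ⊢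
  rw [h.dirac_onFields hc, hs, map_smulₛₗ, Complex.conj_ofReal, smul_smul, hmu]

theorem exists_eigenspace_preimage (h : CliffordTwist J c) (hc : c * c = 1) (hd : d ≠ 0)
    (hJ : ∀ v, J (J v) = d • v) (A : S.Connection) {lam mu : ℝ} (hmu : (mu : ℂ) = c * lam)
    (t : S.conj.spinorFields) (ht : t ∈ S.conj.eigenspace A.neg mu) :
    ∃ s ∈ S.eigenspace A lam, onFields J s.1 = t.1 := by
  have hJJ : ∀ f : ι → M → Spinor n, onFields J (onFields J f) = d • f := fun f => by
    funext α x
    exact hJ _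
  set r : S.spinorFields := ⟨_, h.onFields_mem_of_conj hc t.2⟩
  have hr : onFields J r.1 = d • t.1 := hJJ t.1
  have hr' : (⟨_, h.onFields_mem_conj hc r.2⟩ : S.conj.spinorFields) = d • t := Subtype.ext hr
  have hD := h.dirac_onFields hc A r
  rw [SpinCStructure.mem_eigenspace] at ht
  rw [hr', map_smul, ht] at hD
  have hmem : r ∈ S.eigenspace A lam := by
    rw [SpinCStructure.mem_eigenspace]
    -- The eigenvalue equation for `r = J t` is checked after applying `J`, where it follows from
    -- the one for `t`; no Dirac operator of the twice conjugated structure is needed.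
    refine onFields_injective hd hJ ?_
    rw [map_smulₛₗ, Complex.conj_ofReal, hr]
    have h2 := congrArg (fun f => c • f) hD
    simp only [smul_smul, hc, one_smul] at h2
    rw [← h2, smul_smul, hmu]
    congr 1
    linear_combination d * lam * hc
  -- The scalar is conjugated because `J` is antilinear: it comes out as `d⁻¹` and cancels `J (J t)
  -- = d t`.
  refine ⟨(starRingEnd ℂ d)⁻¹ • r, Submodule.smul_mem _ _ hmem, ?_⟩
  change onFields J ((starRingEnd ℂ d)⁻¹ • r.1) = t.1
  rw [map_smulₛₗ, hr, smul_smul, map_inv₀, Complex.conj_conj, inv_mul_cancel₀ hd, one_smul]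

/-- The action of `J` as a bijection between eigenspaces of `D^A` and `D^{-A}`. -/
noncomputable def eigenspaceEquiv (h : CliffordTwist J c) (hc : c * c = 1) (hd : d ≠ 0)
    (hJ : ∀ v, J (J v) = d • v) (A : S.Connection) {lam mu : ℝ} (hmu : (mu : ℂ) = c * lam) :
    S.eigenspace A lam ≃+ S.conj.eigenspace A.neg mu :=
  AddEquiv.ofBijective
    ({ toFun := fun s => ⟨_, h.onFields_mem_eigenspace hc A hmu s.1 s.2⟩
       map_zero' := Subtype.ext (Subtype.ext (map_zero (onFields J)))
       map_add' := fun s t => Subtype.ext (Subtype.ext (map_add (onFields J) s.1.1 t.1.1)) } :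
      S.eigenspace A lam →+ S.conj.eigenspace A.neg mu)
    ⟨fun s t hst => Subtype.ext (Subtype.ext (onFields_injective hd hJ
      (congrArg (fun w => w.1.1) hst))), fun t => by
      obtain ⟨s, hs, hst⟩ := h.exists_eigenspace_preimage hc hd hJ A hmu t.1 t.2
      exact ⟨⟨s, hs⟩, Subtype.ext (Subtype.ext hst)⟩⟩

/-- The bijection is only conjugate-linear, but a bijection semilinear over a field automorphism
still preserves rank. -/
theorem multiplicity_eq (h : CliffordTwist J c) (hc : c * c = 1) (hd : d ≠ 0)
    (hJ : ∀ v, J (J v) = d • v) (A : S.Connection) {lam mu : ℝ} (hmu : (mu : ℂ) = c * lam) :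
    S.multiplicity A lam = S.conj.multiplicity A.neg mu :=
  rank_eq_of_equiv_equiv (starRingEnd ℂ) (h.eigenspaceEquiv hc hd hJ A hmu)
    Complex.conjAe.bijective
    fun r s => Subtype.ext (Subtype.ext (map_smulₛₗ (onFields J) r s.1.1))

theorem mem_spec_iff (h : CliffordTwist J c) (hc : c * c = 1) (hd : d ≠ 0)
    (hJ : ∀ v, J (J v) = d • v) (A : S.Connection) {lam mu : ℝ} (hmu : (mu : ℂ) = c * lam) :
    lam ∈ S.spec A ↔ mu ∈ S.conj.spec A.neg := by
  change S.eigenspace A lam ≠ ⊥ ↔ S.conj.eigenspace A.neg mu ≠ ⊥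
  rw [← Submodule.nontrivial_iff_ne_bot, ← Submodule.nontrivial_iff_ne_bot]
  exact (h.eigenspaceEquiv hc hd hJ A hmu).toEquiv.nontrivial_congr

end CliffordTwist

end Fields

end SpinCDirac

theorem lemma3p2 {n : ℕ} (hn : 2 ≤ n) {M : Type*} [TopologicalSpace M] [T2Space M]
    [SecondCountableTopology M] [ChartedSpace (EuclideanSpace ℝ (Fin n)) M] [IsManifold (𝓡 n) ∞ M]
    [RiemannianBundle (fun x : M => TangentSpace (𝓡 n) x)]
    [IsContMDiffRiemannianBundle (𝓡 n) ∞ (EuclideanSpace ℝ (Fin n))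
      (fun x : M => TangentSpace (𝓡 n) x)]
    {ι : Type*} (S : SpinCDirac.SpinCStructure n M ι) (A : S.Connection) :
    (¬ n ≡ 1 [MOD 4] → ∀ s : S.spinorFields,
      ∃ hs : SpinCDirac.onFields (SpinCDirac.j₀ n) s.1 ∈ S.conj.spinorFields,
        S.conj.dirac A.neg ⟨_, hs⟩ = SpinCDirac.onFields (SpinCDirac.j₀ n) (S.dirac A s)) ∧
    (∀ s : S.spinorFields,
      ∃ hs : SpinCDirac.onFields (SpinCDirac.j₁ n) s.1 ∈ S.conj.spinorFields,
        S.conj.dirac A.neg ⟨_, hs⟩ =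
          (-1 : ℂ) ^ (n / 2 + 1) • SpinCDirac.onFields (SpinCDirac.j₁ n) (S.dirac A s)) ∧
    (CompactSpace M →
      (Odd (n / 2) → S.spec A = S.conj.spec A.neg ∧
        ∀ lam : ℝ, S.multiplicity A lam = S.conj.multiplicity A.neg lam) ∧
      (Even (n / 2) → S.spec A = {lam | -lam ∈ S.conj.spec A.neg} ∧
        ∀ lam : ℝ, S.multiplicity A lam = S.conj.multiplicity A.neg (-lam))) := by
  have hc : (-1 : ℂ) ^ (n / 2 + 1) * (-1 : ℂ) ^ (n / 2 + 1) = 1 := by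
    rw [← mul_pow]
    norm_num
  obtain ⟨d, hd, hJ⟩ := SpinCDirac.j₁_involutive_up_to_sign n
  have h₁ := SpinCDirac.j₁_cliffordTwist n
  refine ⟨fun h s => ?_, fun s => ⟨_, h₁.dirac_onFields hc A s⟩, fun _ => ⟨fun hm => ?_,
    fun hm => ?_⟩⟩
  · have h₀ := SpinCDirac.j₀_cliffordTwist h
    exact ⟨h₀.onFields_mem_conj (one_mul 1) s.2,
      (h₀.dirac_onFields (one_mul 1) A s).trans (one_smul _ _)⟩
  -- For `m` odd the sign `c` of `j₁` is `1`, so eigenvalues are kept; in the even case below it is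
  -- `-1`, so they are negated.
  · have hmu (lam : ℝ) : (lam : ℂ) = (-1) ^ (n / 2 + 1) * lam := by
      rw [hm.add_one.neg_one_pow, one_mul]
    exact ⟨Set.ext fun lam => h₁.mem_spec_iff hc hd hJ A (hmu lam),
      fun lam => h₁.multiplicity_eq hc hd hJ A (hmu lam)⟩
  · have hmu (lam : ℝ) : ((-lam : ℝ) : ℂ) = (-1) ^ (n / 2 + 1) * lam := by
      rw [hm.add_one.neg_one_pow, neg_one_mul, Complex.ofReal_neg]
    exact ⟨Set.ext fun lam => h₁.mem_spec_iff hc hd hJ A (hmu lam),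
      fun lam => h₁.multiplicity_eq hc hd hJ A (hmu lam)⟩
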